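/- Let $A(Y),B(X)$ be polynomials over the finite field $\mathbb{F}_q$ of coprime degrees $a=\deg A$ and $b=\deg B\ge 2$, with $A(Y)-B(X)$ absolutely irreducible. Let $\mathcal{X}$ be the curve with affine equation $A(Y)=B(X)$, with coordinate functions $x,y$, and let $Q$ be the common and only pole of $x$ and $y$ on (the nonsingular model of) $\mathcal{X}$. Let $v$ be the pole order at $Q$, and let $\mathcal{L}(mQ)$ be the space of rational functions without poles outside $Q$ and with pole order at most $m$ at $Q$. Given $\epsilon_i\in\{0,1\}$ and integers $\ell_i\ge 0$ for $0\le i\le b-2$, put $$V=\sum_{i=0}^{b-2}\epsilon_i\langle 1,y,\dots,y^{\ell_i}\rangle x^i,\qquad m(V)=\max\{\epsilon_i(\ell_i v(y)+i v(x)) : 0\le i\le b-2\}$$ (here $v(x)=a$ and $v(y)=b$), and call $V$ complete if $V=\mathcal{L}(m(V)Q)\cap\bigoplus_{i=0}^{b-2}\mathbb{F}_q[y]x^i$. (1) Let $s=\min\{b-2,\lfloor m(V)/a\rfloor\}$. Then $V$ is complete if and only if, for $0\le i\le b-2$, one has $\epsilon_i=1$ exactly when $i\le s$, and $\ell_i=\lfloor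 (m(V)-ia)/b\rfloor$ for $i=0,\dots,s$. (2) Let $\mathcal{U}$ be the set of $\beta\in\mathbb{F}_q$ for which $B(X)=A(\beta)$ has $b$ distinct solutions in $\mathbb{F}_q$, let $\mathcal{P}$ be the set of points $(\alpha,\beta)\in\mathbb{F}_q^2$ of $\mathcal{X}$ with $\beta\in\mathcal{U}$, let $n=\#\mathcal{P}$, and let $\mathcal{C}(\mathcal{P},V)=\{(f(P))_{P\in\mathcal{P}} : f\in V\}\subseteq\mathbb{F}_q^n$. Suppose that $V$ is complete. If $n>0$ then $\mathcal{C}(\mathcal{P},V)\ne 0$ and its minimum distance $d$ satisfies $d\ge n-m(V)$. If moreover $\lfloor m(V)/b\rfloor b<n$, then $$n-m(V)\le d\le n-\lfloor m(V)/b\rfloor b.$$ -/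

import Mathlib

open Polynomial

noncomputable section

namespace SepVar

/-! ### The curve `A(Y) = B(X)` -/

section Curve

variable {F : Type*} [Field F]

/-- The bivariate polynomial `A(Y) - B(X)`, as a polynomial in `Y` over `F[X]`. -/
def curvePoly (A B : F[X]) : F[X][X] := A.map C - C B

/-- `A(Y) - B(X)` is irreducible over an algebraic closure of `F`. -/
def AbsIrreducible (A B : F[X]) : Prop :=
  Irreducible (curvePoly (A.map (algebraMap F (AlgebraicClosure F)))
    (B.map (algebraMap F (AlgebraicClosure F))))

/-- The affine coordinate ring `F[X, Y] / (A(Y) - B(X))`, that is `F[x, y]`. The function field of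
the curve is the fraction field of this ring. -/
abbrev CoordRing (A B : F[X]) : Type _ := AdjoinRoot (curvePoly A B)

/-- The coset of `X`. -/
def xCoord (A B : F[X]) : CoordRing A B := AdjoinRoot.of (curvePoly A B) X

/-- The coset of `Y`. -/
def yCoord (A B : F[X]) : CoordRing A B := AdjoinRoot.root (curvePoly A B)

lemma eval₂_curvePoly (A B : F[X]) (α β : F) (h : A.eval β = B.eval α) :
    (curvePoly A B).eval₂ (aeval α : F[X] →ₐ[F] F) β = 0 := by
  simp only [curvePoly, eval₂_sub, eval₂_C, eval₂_map]
  have : (RingHom.comp (↑(aeval α : F[X] →ₐ[F] F)) (C : F →+* F[X])) = RingHom.id F := by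
    ext c; simp
  rw [this]
  simp [← h, eval₂_id]

/-- Evaluation of a function of `F[x, y]` at the rational affine point `(α, β)`, for
`A(β) = B(α)`. -/
def evalAt (A B : F[X]) (α β : F) (h : A.eval β = B.eval α) : CoordRing A B →ₐ[F] F :=
  AdjoinRoot.liftAlgHom (curvePoly A B) (aeval α : F[X] →ₐ[F] F) β (eval₂_curvePoly A B α β h)

end Curve

/-! ### Places, pole orders and Riemann spaces -/

section Places

variable (F : Type*) [Field F] (K : Type*) [Field K] [Algebra F K]

/-- A place of the function field `K / F` (a closed point of the nonsingular projective model):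
a discrete valuation ring of `K` that contains the constants. -/
structure Place where
  ring : ValuationSubring K
  algebraMap_mem : ∀ c : F, algebraMap F K c ∈ ring
  isDVR : IsDiscreteValuationRing ring

attribute [instance] Place.isDVR

variable {F K}

/-- The normalized valuation at `Q`, written multiplicatively: its value at `f ≠ 0` is
`WithZero.exp n`, where `-n` is the order of vanishing of `f` at `Q`. -/
def Place.val (Q : Place F K) : Valuation K (WithZero (Multiplicative ℤ)) :=
  (IsDiscreteValuationRing.maximalIdeal Q.ring).valuation K

/-- The pole order `v(f)` of `f ≠ 0` at `Q` (minus the order of vanishing). -/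
def Place.poleOrder (Q : Place F K) (f : K) : ℤ := WithZero.log (Q.val f)

/-- `Q` is a pole of `f`, and the only one. -/
def Place.IsOnlyPole (Q : Place F K) (f : K) : Prop := ∀ P : Place F K, f ∉ P.ring ↔ P = Q

lemma Place.val_algebraMap_le (Q : Place F K) (c : F) : Q.val (algebraMap F K c) ≤ 1 :=
  (IsDiscreteValuationRing.maximalIdeal Q.ring).valuation_le_one
    (⟨algebraMap F K c, Q.algebraMap_mem c⟩ : Q.ring)

/-- The Riemann space `𝓛(mQ)`: functions without poles outside `Q` whose pole order at `Q` is at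
most `m`, together with `0`. -/
def riemannSpace (Q : Place F K) (m : ℤ) : Submodule F K where
  carrier := {f | (∀ P : Place F K, P ≠ Q → f ∈ P.ring) ∧ Q.val f ≤ WithZero.exp m}
  zero_mem' := ⟨fun P _ => P.ring.zero_mem, by simp⟩
  add_mem' := fun {f g} hf hg =>
    ⟨fun P hP => P.ring.add_mem _ _ (hf.1 P hP) (hg.1 P hP), Q.val.map_add_le hf.2 hg.2⟩
  smul_mem' := fun c f hf => by
    refine ⟨fun P hP => ?_, ?_⟩
    · rw [Algebra.smul_def]
      exact P.ring.mul_mem _ _ (P.algebraMap_mem c) (hf.1 P hP)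
    · rw [Algebra.smul_def, map_mul]
      exact (mul_le_of_le_one_left' (Q.val_algebraMap_le c)).trans hf.2

end Places

/-! ### The linear spaces of functions -/

section Spaces

variable {F : Type*} [Field F] {K : Type*} [Field K] [Algebra F K]

/-- The space `V = ∑_{i < r} ε_i ⟨1, φ₁, …, φ₁ ^ ℓ_i⟩ φ₂ ^ i`. -/
def funSpace (F : Type*) [Field F] {K : Type*} [Field K] [Algebra F K] (φ₁ φ₂ : K) {r : ℕ}
    (ε : Fin r → Fin 2) (ℓ : Fin r → ℕ) : Submodule F K :=
  ⨆ i : Fin r, ⨆ _ : ε i = 1,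
    Submodule.span F {f : K | ∃ j : ℕ, j ≤ ℓ i ∧ f = φ₁ ^ j * φ₂ ^ (i : ℕ)}

/-- The number `m(V) = max {ε_i (ℓ_i v(φ₁) + i v(φ₂)) : i < r}`, for `r ≥ 1`. -/
def mOf (Q : Place F K) (φ₁ φ₂ : K) {r : ℕ} (ε : Fin r → Fin 2) (ℓ : Fin r → ℕ) : ℤ :=
  ⨆ i : Fin r, (((ε i : ℕ) : ℤ) *
    ((ℓ i : ℤ) * Q.poleOrder φ₁ + ((i : ℕ) : ℤ) * Q.poleOrder φ₂))

/-- The space `𝓛(mQ) ∩ ∑_{i < r} F[φ₁] φ₂ ^ i`. -/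
def fullSpace (Q : Place F K) (φ₁ φ₂ : K) (r : ℕ) (m : ℤ) : Submodule F K :=
  riemannSpace Q m ⊓
    ⨆ i : Fin r, Submodule.span F (Set.range fun j : ℕ => φ₁ ^ j * φ₂ ^ (i : ℕ))

/-- The space `V` given by `ε` and `ℓ` is complete: it equals its completion. -/
def IsComplete (Q : Place F K) (φ₁ φ₂ : K) {r : ℕ} (ε : Fin r → Fin 2) (ℓ : Fin r → ℕ) : Prop :=
  funSpace F φ₁ φ₂ ε ℓ = fullSpace Q φ₁ φ₂ r (mOf Q φ₁ φ₂ ε ℓ)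

end Spaces

/-! ### The codes -/

section Codes

variable {F : Type*} [Field F] [Fintype F] [DecidableEq F]

/-- The `β ∈ F` over which the fibre of `y` consists of `deg B` distinct rational points. -/
def splitSet (A B : F[X]) : Finset F :=
  Finset.univ.filter fun β =>
    (Finset.univ.filter fun α : F => B.eval α = A.eval β).card = B.natDegree

/-- The evaluation points: the rational affine points `(α, β)` of the curve that lie in a fibre
of `y` over the previous set. -/
def evalPoints (A B : F[X]) : Finset (F × F) :=
  Finset.univ.filter fun p => A.eval p.2 = B.eval p.1 ∧ p.2 ∈ splitSet A B

lemma evalPoints_eq {A B : F[X]} (p : evalPoints A B) : A.eval p.1.2 = B.eval p.1.1 :=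
  (Finset.mem_filter.mp p.2).2.1

/-- The evaluation map `f ↦ (f(P))_P`. -/
def ev (A B : F[X]) : CoordRing A B →ₗ[F] (evalPoints A B → F) :=
  LinearMap.pi fun p => (evalAt A B p.1.1 p.1.2 (evalPoints_eq p)).toLinearMap

/-- The code obtained by evaluating the functions of `V`, for a space `V ⊆ F[x, y]` of elements of
the function field `K`. -/
def evalCode (A B : F[X]) {K : Type*} [Field K] [Algebra F K] [Algebra (CoordRing A B) K]
    [IsScalarTower F (CoordRing A B) K] (V : Submodule F K) : Submodule F (evalPoints A B → F) :=
  (V.comap (IsScalarTower.toAlgHom F (CoordRing A B) K).toLinearMap).map (ev A B)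

/-- The minimum distance of a nonzero linear code: the least Hamming distance between two distinct
codewords. -/
def minDist {ι : Type*} [Fintype ι] (𝒞 : Submodule F (ι → F)) : ℕ :=
  sInf {d | ∃ u ∈ 𝒞, ∃ w ∈ 𝒞, u ≠ w ∧ hammingDist u w = d}

end Codes

end SepVar

end

open SepVar

open SepVar

/-! The monomials `y ^ j * x ^ i` with `i < b` have pole orders `j * b + i * a` at `Q`, pairwise
distinct because `a` and `b` are coprime. No cancellation of leading terms can occur: a combination
has the largest pole order among its terms, and the monomials are linearly independent
(`exists_val_linearCombination`, `monoDeg_injective`). Hence `V` and its completion are both spanned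
by sets of monomials, and completeness is equality of two sets of exponents
(`fullSpace_eq_span_mono`, `exponents_eq_iff`).

That `x` and `y` have pole orders exactly `a` and `b` is proved in `Place.val_coords`: the equation
`A(y) = B(x)` gives `a * t` and `b * t`, and `t = 1` because the value group of the fraction field
is all of `ℤ`.

The lower bound on the distance says that a function has at most as many rational zeros as its pole
order. `card_zeros_le` gets this without divisors, by comparing the dimensions of the spaces of
functions of bounded pole order. The upper bound comes from a product of `⌊m / b⌋` factors `y - β`
with `β` in the split set, each vanishing on a full fibre of `b` points. -/

namespace SepVar
open WithZero

/-! ### Spans of elements with distinct values -/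

/-- Combinations of elements whose values are distinct at a valuation trivial on scalars. -/
theorem exists_val_linearCombination {F R ι : Type*} [Field F] [CommRing R] [Algebra F R]
    (v : Valuation R (WithZero (Multiplicative ℤ)))
    [v.IsTrivialOn F]
    {e : ι → R} {D : ι → ℤ} (he : ∀ i, v (e i) = exp (D i)) (hD : Function.Injective D)
    (c : ι →₀ F) (hc : c ≠ 0) :
    ∃ i ∈ c.support, v (Finsupp.linearCombination F e c) = exp (D i) ∧
      ∀ j ∈ c.support, D j ≤ D i := by
  classical
  obtain ⟨i, hi, hmax⟩ := c.support.exists_max_image D (Finsupp.support_nonempty_iff.2 hc)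
  have hval : ∀ j ∈ c.support, v (c j • e j) = exp (D j) := fun j hj => by
    rw [Algebra.smul_def, map_mul, Valuation.IsTrivialOn.eq_one (v := v) _ (Finsupp.mem_support_iff.1 hj),
      one_mul, he]
  refine ⟨i, hi, ?_, hmax⟩
  rw [Finsupp.linearCombination_apply, Finsupp.sum, v.map_sum_eq_of_lt hi, hval i hi]
  intro j hj
  simp only [Finset.mem_sdiff, Finset.mem_singleton] at hj
  rw [hval i hi, hval j hj.1, exp_lt_exp]
  exact lt_of_le_of_ne (hmax j hj.1) fun h => hj.2 (hD h)

theorem linearIndependent_of_val_injective {F R ι : Type*} [Field F] [CommRing R] [Algebra F R]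
    (v : Valuation R (WithZero (Multiplicative ℤ)))
    [v.IsTrivialOn F]
    {e : ι → R} {D : ι → ℤ} (he : ∀ i, v (e i) = exp (D i)) (hD : Function.Injective D) :
    LinearIndependent F e := by
  rw [linearIndependent_iff]
  intro c hc
  by_contra h
  obtain ⟨i, -, h1, -⟩ := exists_val_linearCombination v he hD c h
  rw [hc, map_zero] at h1
  exact exp_ne_zero h1.symm

/-- The elements of value at most `exp N` in the span of elements with distinct values. -/
theorem mem_span_image_le_iff {F R ι : Type*} [Field F] [CommRing R] [Algebra F R]
    (v : Valuation R (WithZero (Multiplicative ℤ)))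
    [v.IsTrivialOn F]
    {e : ι → R} {D : ι → ℤ} (he : ∀ i, v (e i) = exp (D i)) (hD : Function.Injective D)
    (N : ℤ) (f : R) :
    f ∈ Submodule.span F (e '' {i | D i ≤ N}) ↔
      f ∈ Submodule.span F (Set.range e) ∧ v f ≤ exp N := by
  constructor
  · intro h
    refine ⟨Submodule.span_mono (Set.image_subset_range _ _) h, ?_⟩
    obtain ⟨c, hc, rfl⟩ := (Finsupp.mem_span_image_iff_linearCombination F).1 h
    by_cases hc0 : c = 0
    · simp [hc0]
    · obtain ⟨i, hi, h1, -⟩ := exists_val_linearCombination v he hD c hc0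
      rw [h1, exp_le_exp]
      exact (Finsupp.mem_supported F c).1 hc hi
  · rintro ⟨h, hN⟩
    obtain ⟨c, rfl⟩ := (Finsupp.mem_span_range_iff_exists_finsupp).1 h
    change v (Finsupp.linearCombination F e c) ≤ _ at hN
    refine (Finsupp.mem_span_image_iff_linearCombination F).2 ⟨c, ?_, rfl⟩
    by_cases hc0 : c = 0
    · simp [hc0]
    · obtain ⟨i, hi, h1, h2⟩ := exists_val_linearCombination v he hD c hc0
      rw [h1, exp_le_exp] at hN
      exact (Finsupp.mem_supported F c).2 fun j hj => (h2 j hj).trans hN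

/-- Subsets of a linearly independent family are determined by their spans. -/
theorem span_image_eq_iff {F R ι : Type*} [Field F] [AddCommGroup R] [Module F R]
    {e : ι → R} (he : LinearIndependent F e) (S T : Set ι) :
    Submodule.span F (e '' S) = Submodule.span F (e '' T) ↔ S = T := by
  constructor
  · intro h
    ext i
    constructor
    · intro hi
      by_contra hn
      exact he.notMem_span_image hn (h ▸ Submodule.subset_span ⟨i, hi, rfl⟩)
    · intro hi
      by_contra hn
      exact he.notMem_span_image hn (h ▸ Submodule.subset_span ⟨i, hi, rfl⟩)
  · rintro rfl; rfl

/-! ### Valuations at places -/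

section PlaceLemmas
variable {F : Type*} [Field F] {K : Type*} [Field K] [Algebra F K]

instance Place.isTrivialOn_val (Q : Place F K) : Q.val.IsTrivialOn F where
  eq_one c hc := by
    refine le_antisymm (Q.val_algebraMap_le c) ?_
    have h := Q.val_algebraMap_le c⁻¹
    rw [map_inv₀, map_inv₀] at h
    have h0 : Q.val (algebraMap F K c) ≠ 0 := by simpa using hc
    exact (inv_le_one₀ (zero_lt_iff.2 h0)).1 h

theorem Place.one_lt_val (Q : Place F K) {f : K} (hf : f ∉ Q.ring) : 1 < Q.val f := by
  by_contra h
  obtain ⟨g, rfl⟩ := IsDiscreteValuationRing.exists_lift_of_le_one (not_lt.1 h)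
  exact hf g.2

theorem Place.exists_val_eq_exp_one (Q : Place F K) : ∃ f : K, Q.val f = exp 1 := by
  obtain ⟨p, hp⟩ := (IsDiscreteValuationRing.maximalIdeal Q.ring).valuation_exists_uniformizer K
  refine ⟨p⁻¹, ?_⟩
  change Q.val p = _ at hp
  rw [map_inv₀, hp, ← exp_neg, neg_neg]

end PlaceLemmas

/-! ### Monomials in the coordinate ring -/

section Monomials
variable {F : Type*} [Field F]

/-- The monomials `y ^ j * x ^ i` with `i < r`. -/
def mono {R : Type*} [CommRing R] (y x : R) (r : ℕ) (p : Fin r × ℕ) : R := y ^ p.2 * x ^ (p.1 : ℕ)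

/-- The pole order of `y ^ j * x ^ i` when `x`, `y` have pole orders `a`, `b`. -/
def monoDeg (a b r : ℕ) (p : Fin r × ℕ) : ℕ := p.2 * b + p.1 * a

/-- Modulo `b` the degree determines `i * a`, hence `i`, since `a` is invertible modulo `b` and `i <
r ≤ b`. -/
theorem monoDeg_injective {a b r : ℕ} (hab : Nat.Coprime a b) (hr : r ≤ b) :
    Function.Injective (monoDeg a b r) := by
  rintro ⟨i, j⟩ ⟨i', j'⟩ h
  simp only [monoDeg] at h
  have hi : (i : ℕ) = i' := by
    have h1 : (i : ℕ) * a ≡ i' * a [MOD b] := by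
      have : (j * b + i * a) % b = (j' * b + i' * a) % b := by rw [h]
      rw [Nat.mul_add_mod_self_right, Nat.mul_add_mod_self_right] at this
      exact this
    have h2 := Nat.ModEq.cancel_right_of_coprime (by rwa [Nat.coprime_comm] at hab) h1
    exact Nat.ModEq.eq_of_lt_of_lt h2 (by omega) (by omega)
  have hb : 0 < b := by have := i.2; omega
  have hj : j = j' := by
    rw [hi] at h
    exact Nat.eq_of_mul_eq_mul_right hb (by omega)
  ext <;> simp [hi, hj]

/-- The factor `t` is the ramification still unknown when this is used to compute the pole orders of
`x` and `y`; later uses take `t = 1`. -/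
theorem val_mono {R : Type*} [CommRing R] (v : Valuation R (WithZero (Multiplicative ℤ)))
    {x y : R} {a b t : ℕ} (hx : v x = exp (((a * t : ℕ)) : ℤ)) (hy : v y = exp ((b * t : ℕ) : ℤ))
    (r : ℕ) (p : Fin r × ℕ) : v (mono y x r p) = exp ((t * monoDeg a b r p : ℕ) : ℤ) := by
  rw [mono, map_mul, map_pow, map_pow, hx, hy, ← exp_nsmul, ← exp_nsmul, ← exp_add]
  congr 1
  simp only [monoDeg, nsmul_eq_mul]
  push_cast
  ring

theorem aeval_xCoord (A B : F[X]) : aeval (xCoord A B) B = aeval (yCoord A B) A := by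
  have h : eval₂ (AdjoinRoot.of (curvePoly A B)) (yCoord A B) (A.map C - C B) = 0 :=
    AdjoinRoot.eval₂_root (curvePoly A B)
  rw [eval₂_sub, eval₂_C, eval₂_map, sub_eq_zero] at h
  have h1 : (aeval (xCoord A B) : F[X] →ₐ[F] _).toRingHom = AdjoinRoot.of (curvePoly A B) := by
    ext c
    · simp; rfl
    · simp; rfl
  exact (congrArg (fun g : F[X] →+* _ => g B) h1).trans h.symm

/-- The monomials `y ^ j * x ^ i` with `i < deg B` span the coordinate ring. -/
theorem span_mono_eq_top (A B : F[X]) (hB : 0 < B.natDegree) :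
    Submodule.span F (Set.range (mono (yCoord A B) (xCoord A B) B.natDegree)) = ⊤ := by
  set x := xCoord A B with hxdef
  set y := yCoord A B with hydef
  set M := Submodule.span F (Set.range (mono y x B.natDegree)) with hM
  have hmono : ∀ i j : ℕ, i < B.natDegree → y ^ j * x ^ i ∈ M := fun i j hi =>
    Submodule.subset_span ⟨(⟨i, hi⟩, j), rfl⟩
  have hrel : aeval x B = aeval y A := aeval_xCoord A B
  -- By linearity, stability of the span under multiplication need only be tested on monomials.
  have hclosed : ∀ z : CoordRing A B, (∀ i j : ℕ, i < B.natDegree → z * (y ^ j * x ^ i) ∈ M) →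
      ∀ f ∈ M, z * f ∈ M := by
    intro z hz f hf
    induction hf using Submodule.span_induction with
    | mem f hf => obtain ⟨p, rfl⟩ := hf; exact hz _ _ p.1.2
    | zero => simp
    | add f g _ _ hf hg => rw [mul_add]; exact M.add_mem hf hg
    | smul c f _ hf => rw [mul_smul_comm]; exact M.smul_mem c hf
  have hy : ∀ f ∈ M, y * f ∈ M := hclosed y fun i j hi => by
    rw [← mul_assoc, ← pow_succ']; exact hmono _ _ hi
  have hypoly : ∀ (g : F[X]), ∀ f ∈ M, aeval y g * f ∈ M := by
    intro g f hf
    induction g using Polynomial.induction_on' with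
    | add p q hp hq => rw [map_add, add_mul]; exact M.add_mem hp hq
    | monomial n c =>
      rw [aeval_monomial, mul_assoc, ← Algebra.smul_def]
      refine M.smul_mem c ?_
      induction n with
      | zero => simpa using hf
      | succ n ih => rw [pow_succ', mul_assoc]; exact hy _ ih
  -- The curve equation is solved for its leading term in `x`, which reduces the exponent below `b`.
  have hxb : x ^ B.natDegree ∈ M := by
    have h1 : B.leadingCoeff • x ^ B.natDegree =
        aeval y A * 1 - ∑ i ∈ Finset.range B.natDegree, B.coeff i • x ^ i := by
      rw [mul_one, ← hrel, aeval_eq_sum_range, Finset.sum_range_succ]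
      simp
    have h2 : B.leadingCoeff • x ^ B.natDegree ∈ M := by
      rw [h1]
      refine M.sub_mem (hypoly A 1 ?_) (M.sum_mem fun i hi => M.smul_mem _ ?_)
      · simpa using hmono 0 0 hB
      · simpa using hmono i 0 (Finset.mem_range.1 hi)
    have h0 : B.leadingCoeff ≠ 0 := by
      intro h; rw [leadingCoeff_eq_zero] at h; simp [h] at hB
    exact (M.smul_mem_iff h0).1 h2
  have hx : ∀ f ∈ M, x * f ∈ M := hclosed x fun i j hi => by
    rw [mul_left_comm, ← pow_succ']
    rcases Nat.lt_or_ge (i + 1) B.natDegree with h | h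
    · exact hmono _ _ h
    · have : i + 1 = B.natDegree := by omega
      rw [this]
      simpa using hypoly (X ^ j) _ hxb
  have hxpoly : ∀ (g : F[X]), ∀ f ∈ M, AdjoinRoot.of (curvePoly A B) g * f ∈ M := by
    intro g f hf
    induction g using Polynomial.induction_on' with
    | add p q hp hq => rw [map_add, add_mul]; exact M.add_mem hp hq
    | monomial n c =>
      have : AdjoinRoot.of (curvePoly A B) (monomial n c) = c • x ^ n := by
        rw [← C_mul_X_pow_eq_monomial, map_mul, map_pow, Algebra.smul_def]; rfl
      rw [this, smul_mul_assoc]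
      refine M.smul_mem c ?_
      induction n with
      | zero => simpa using hf
      | succ n ih =>
        rw [pow_succ', mul_assoc]
        exact hx _ (ih (by rw [← C_mul_X_pow_eq_monomial, map_mul, map_pow, Algebra.smul_def]; rfl))
  rw [eq_top_iff]
  rintro f -
  induction f using AdjoinRoot.induction_on with | ih p =>
  induction p using Polynomial.induction_on' with
  | add p q hp hq => rw [map_add]; exact M.add_mem hp hq
  | monomial n g =>
    rw [← C_mul_X_pow_eq_monomial, map_mul, map_pow]
    refine hxpoly g _ ?_
    have h := hmono 0 n hB
    rwa [pow_zero, mul_one] at h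

end Monomials

/-- The monomials span the ring and have values at distinct multiples of `t`, so the dominant term
of `f` decides its value. -/
theorem exists_val_eq_exp_monoDeg {F : Type*} [Field F] {A B : F[X]} {a t : ℕ} (ht : 0 < t)
    (hB : 0 < B.natDegree) (hab : Nat.Coprime a B.natDegree)
    (v : Valuation (CoordRing A B) (WithZero (Multiplicative ℤ))) [v.IsTrivialOn F]
    (hx : v (xCoord A B) = exp ((a * t : ℕ) : ℤ))
    (hy : v (yCoord A B) = exp ((B.natDegree * t : ℕ) : ℤ))
    {f : CoordRing A B} (hf : f ≠ 0) : ∃ w : ℕ, v f = exp ((t * w : ℕ) : ℤ) := by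
  have hmem : f ∈ Submodule.span F (Set.range (mono (yCoord A B) (xCoord A B) B.natDegree)) := by
    rw [span_mono_eq_top A B hB]; trivial
  obtain ⟨c, rfl⟩ := (Finsupp.mem_span_range_iff_exists_finsupp).1 hmem
  obtain ⟨i, -, h, -⟩ := exists_val_linearCombination (F := F) v
    (D := fun p => ((t * monoDeg a B.natDegree B.natDegree p : ℕ) : ℤ))
    (fun p => val_mono v hx hy B.natDegree p) (fun p q h =>
      monoDeg_injective hab le_rfl (Nat.eq_of_mul_eq_mul_left ht (Int.ofNat_inj.1 h))) c
    (by rintro rfl; simp at hf)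
  exact ⟨_, h⟩

/-! ### Pole orders of the coordinate functions -/

section FunctionField

variable {F : Type*} [Field F] {A B : F[X]} {K : Type*} [Field K] [Algebra F K]
  [Algebra (CoordRing A B) K]

theorem aeval_algebraMap_coords [IsScalarTower F (CoordRing A B) K] :
    aeval (algebraMap (CoordRing A B) K (xCoord A B)) B =
      aeval (algebraMap (CoordRing A B) K (yCoord A B)) A := by
  rw [aeval_algebraMap_apply, aeval_algebraMap_apply, aeval_xCoord]

/-- The valuation of the coordinate ring induced by a place of the function field. -/
noncomputable def Place.coordVal (Q : Place F K) :
    Valuation (CoordRing A B) (WithZero (Multiplicative ℤ)) :=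
  Q.val.comap (algebraMap (CoordRing A B) K)

theorem Place.coordVal_apply (Q : Place F K) (f : CoordRing A B) :
    Q.coordVal f = Q.val (algebraMap (CoordRing A B) K f) := rfl

instance Place.isTrivialOn_coordVal [IsScalarTower F (CoordRing A B) K] (Q : Place F K) :
    (Q.coordVal (A := A) (B := B)).IsTrivialOn F where
  eq_one c hc := by
    rw [Place.coordVal_apply, ← IsScalarTower.algebraMap_apply]
    exact Valuation.IsTrivialOn.eq_one (v := Q.val) c hc

/-- The common pole of the coordinate functions is totally ramified over both of them. -/
theorem Place.val_coords [IsScalarTower F (CoordRing A B) K]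
    [IsFractionRing (CoordRing A B) K] (Q : Place F K)
    (hB : 2 ≤ B.natDegree) (hab : Nat.Coprime A.natDegree B.natDegree)
    (hx : 1 < Q.val (algebraMap (CoordRing A B) K (xCoord A B)))
    (hy : 1 < Q.val (algebraMap (CoordRing A B) K (yCoord A B))) :
    Q.val (algebraMap (CoordRing A B) K (xCoord A B)) = exp (A.natDegree : ℤ) ∧
      Q.val (algebraMap (CoordRing A B) K (yCoord A B)) = exp (B.natDegree : ℤ) := by
  set x := algebraMap (CoordRing A B) K (xCoord A B) with hxdef
  set y := algebraMap (CoordRing A B) K (yCoord A B) with hydef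
  have hB0 : B ≠ 0 := by rintro rfl; simp at hB
  have hA : 0 < A.natDegree := by
    rcases Nat.eq_zero_or_pos A.natDegree with h | h
    · rw [h, Nat.coprime_zero_left] at hab; omega
    · exact h
  have hA0 : A ≠ 0 := by rintro rfl; simp at hA
  -- At a pole the leading term dominates, so the two sides of `B(x) = A(y)` have these values.
  have hpow : Q.val x ^ B.natDegree = Q.val y ^ A.natDegree := by
    rw [← valuation_aeval_eq_valuation_X_pow_natDegree_of_one_lt_valuation_X x hx hB0,
      ← valuation_aeval_eq_valuation_X_pow_natDegree_of_one_lt_valuation_X y hy hA0]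
    exact congrArg Q.val aeval_algebraMap_coords
  have hx0 : Q.val x ≠ 0 := (zero_lt_one.trans hx).ne'
  have hy0 : Q.val y ≠ 0 := (zero_lt_one.trans hy).ne'
  have hlogx : 0 < log (Q.val x) := by
    rw [← exp_lt_exp, exp_log hx0]; exact hx
  have hlogy : 0 < log (Q.val y) := by
    rw [← exp_lt_exp, exp_log hy0]; exact hy
  obtain ⟨k, hk⟩ := Int.eq_ofNat_of_zero_le hlogx.le
  obtain ⟨l, hl⟩ := Int.eq_ofNat_of_zero_le hlogy.le
  have hkl : B.natDegree * k = A.natDegree * l := by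
    have := congrArg log hpow
    rw [log_pow, log_pow, hk, hl, nsmul_eq_mul, nsmul_eq_mul] at this
    exact_mod_cast this
  obtain ⟨t, rfl⟩ : A.natDegree ∣ k := hab.dvd_of_dvd_mul_left ⟨l, hkl⟩
  have hlt : l = B.natDegree * t :=
    Nat.eq_of_mul_eq_mul_left hA (by rw [← hkl]; ring)
  subst hlt
  have hvx : Q.val x = exp ((A.natDegree * t : ℕ) : ℤ) := by rw [← hk, exp_log hx0]
  have hvy : Q.val y = exp ((B.natDegree * t : ℕ) : ℤ) := by rw [← hl, exp_log hy0]
  have ht : 0 < t := by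
    rcases Nat.eq_zero_or_pos t with rfl | h
    · rw [hk] at hlogx; simp at hlogx
    · exact h
  -- An element with a simple pole is a quotient of two regular functions, whose values are
  -- multiples of `t`; so `t` divides 1.
  obtain ⟨f, hf⟩ := Q.exists_val_eq_exp_one
  obtain ⟨g, h, hh, rfl⟩ := IsFractionRing.div_surjective (A := CoordRing A B) f
  have hh0 : h ≠ 0 := by
    rintro rfl
    rw [map_zero, div_zero, map_zero] at hf
    exact exp_ne_zero hf.symm
  have hg0 : g ≠ 0 := by
    rintro rfl
    rw [map_zero, zero_div, map_zero] at hf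
    exact exp_ne_zero hf.symm
  obtain ⟨w, hw⟩ := exists_val_eq_exp_monoDeg ht (by omega) hab Q.coordVal hvx hvy hg0
  obtain ⟨u, hu⟩ := exists_val_eq_exp_monoDeg ht (by omega) hab Q.coordVal hvx hvy hh0
  rw [Place.coordVal_apply] at hw hu
  rw [map_div₀, hw, hu, ← exp_sub, exp_inj] at hf
  have ht1 : t = 1 := by
    have : (t : ℤ) ∣ 1 := ⟨(w : ℤ) - u, by rw [← hf]; push_cast; ring⟩
    exact Nat.dvd_one.1 (by exact_mod_cast this)
  subst ht1
  rw [mul_one] at hvx hvy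
  exact ⟨hvx, hvy⟩

end FunctionField

/-! ### Evaluation at rational points and counting zeros -/

section Evaluation

variable {F : Type*} [Field F] [Fintype F] [DecidableEq F]

theorem ev_xCoord (A B : F[X]) (p : evalPoints A B) : ev A B (xCoord A B) p = p.1.1 := by
  change evalAt A B p.1.1 p.1.2 (evalPoints_eq p) (AdjoinRoot.of (curvePoly A B) X) = p.1.1
  rw [evalAt, AdjoinRoot.liftAlgHom_of]
  simp

theorem ev_yCoord (A B : F[X]) (p : evalPoints A B) : ev A B (yCoord A B) p = p.1.2 := by
  change evalAt A B p.1.1 p.1.2 (evalPoints_eq p) (AdjoinRoot.root (curvePoly A B)) = p.1.2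
  rw [evalAt, AdjoinRoot.liftAlgHom_root]

theorem ev_mul (A B : F[X]) (f g : CoordRing A B) : ev A B (f * g) = ev A B f * ev A B g := by
  ext p
  exact map_mul (evalAt A B p.1.1 p.1.2 (evalPoints_eq p)) f g

theorem ev_one (A B : F[X]) : ev A B 1 = 1 := by
  ext p
  exact map_one (evalAt A B p.1.1 p.1.2 (evalPoints_eq p))

theorem ev_aeval (A B : F[X]) (f : CoordRing A B) (g : F[X]) (p : evalPoints A B) :
    ev A B (aeval f g) p = g.eval (ev A B f p) := by
  change evalAt A B p.1.1 p.1.2 (evalPoints_eq p) (aeval f g) =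
    g.eval (evalAt A B p.1.1 p.1.2 (evalPoints_eq p) f)
  rw [← aeval_algHom_apply, coe_aeval_eq_eval]

theorem exists_ev_eq_single (A B : F[X]) (p : evalPoints A B) :
    ∃ f, ev A B f = Pi.single p 1 := by
  classical
  -- Since nonzero elements satisfy `z ^ (q - 1) = 1`, the polynomial `1 - (X - c) ^ (q - 1)` is the
  -- indicator of `c`.
  have hone : ∀ c : F, ∃ g : F[X], g.eval c = 1 ∧ ∀ d, d ≠ c → g.eval d = 0 := fun c =>
    ⟨1 - (X - C c) ^ (Fintype.card F - 1), by
      have : Fintype.card F - 1 ≠ 0 := by have := Fintype.one_lt_card (α := F); omega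
      simp [this], fun d hd => by simp [FiniteField.pow_card_sub_one_eq_one _ (sub_ne_zero.2 hd)]⟩
  obtain ⟨g, hg1, hg0⟩ := hone p.1.1
  obtain ⟨h, hh1, hh0⟩ := hone p.1.2
  refine ⟨aeval (xCoord A B) g * aeval (yCoord A B) h, ?_⟩
  ext p'
  rw [ev_mul, Pi.mul_apply, ev_aeval, ev_aeval, ev_xCoord, ev_yCoord]
  by_cases hp : p' = p
  · subst hp; simp [hg1, hh1]
  · rw [Pi.single_eq_of_ne hp]
    by_cases h1 : p'.1.1 = p.1.1
    · have h2 : p'.1.2 ≠ p.1.2 := fun h2 => hp (Subtype.ext (Prod.ext h1 h2))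
      rw [hh0 _ h2, mul_zero]
    · rw [hg0 _ h1, zero_mul]

/-- A nonzero regular function has at most as many zeros as its pole order at infinity. -/
theorem card_zeros_le {A B : F[X]} {a : ℕ} (hB : 0 < B.natDegree)
    (hab : Nat.Coprime a B.natDegree)
    (v : Valuation (CoordRing A B) (WithZero (Multiplicative ℤ))) [v.IsTrivialOn F]
    (hx : v (xCoord A B) = exp (a : ℤ)) (hy : v (yCoord A B) = exp (B.natDegree : ℤ))
    {f : CoordRing A B} (hf : f ≠ 0) {m : ℤ} (hm : v f ≤ exp m)
    (Z : Finset (evalPoints A B)) (hZ : ∀ p ∈ Z, ev A B f p = 0) : (Z.card : ℤ) ≤ m := by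
  classical
  set b := B.natDegree with hb
  have hx' : v (xCoord A B) = exp ((a * 1 : ℕ) : ℤ) := by rw [mul_one, hx]
  have hy' : v (yCoord A B) = exp ((b * 1 : ℕ) : ℤ) := by rw [mul_one, hy]
  have hval : ∀ {g : CoordRing A B}, g ≠ 0 → ∃ w : ℕ, v g = exp (w : ℤ) := fun hg => by
    simpa using exists_val_eq_exp_monoDeg one_pos hB hab v hx' hy' hg
  obtain ⟨w, hw⟩ := hval hf
  rw [hw, exp_le_exp] at hm
  refine le_trans ?_ hm
  norm_cast
  set e := mono (yCoord A B) (xCoord A B) b with he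
  have hinj : Function.Injective (monoDeg a b b) := monoDeg_injective hab le_rfl
  have hinjZ : Function.Injective (fun p => (monoDeg a b b p : ℤ)) := Nat.cast_injective.comp hinj
  have heval : ∀ p, v (e p) = exp (monoDeg a b b p : ℤ) := fun p => by
    simpa using val_mono v hx' hy' b p
  have hli : LinearIndependent F e := linearIndependent_of_val_injective v heval hinjZ
  set S : ℕ → Set (Fin b × ℕ) := fun N => {p | monoDeg a b b p ≤ N} with hS
  set L : ℕ → Submodule F (CoordRing A B) := fun N => Submodule.span F (e '' S N) with hL
  -- As the monomials span the whole ring, `L N` consists of all regular functions of pole order at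
  -- most `N`.
  have hmemL : ∀ N g, g ∈ L N ↔ v g ≤ exp (N : ℤ) := fun N g => by
    have h := mem_span_image_le_iff (F := F) v heval hinjZ N g
    rw [span_mono_eq_top A B hB] at h
    simpa [hL, hS] using h
  have hfin : ∀ N, (S N).Finite := fun N => (Set.finite_Iic N).preimage hinj.injOn
  have hrank : ∀ N, Module.finrank F (L N) = (S N).ncard := fun N => by
    have : Fintype (S N) := (hfin N).fintype
    have h := finrank_span_eq_card (hli.comp (fun p : S N => p.1) Subtype.val_injective)
    rw [Set.range_comp, Subtype.range_coe] at h
    rw [hL, h, ← Nat.card_eq_fintype_card]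
    rfl
  have hfd : ∀ N, Module.Finite F (L N) := fun N =>
    Module.Finite.span_of_finite F ((hfin N).image e)
  -- Each of the `w` integers in `(N, N + w]` is the degree of at most one monomial.
  have hcount : ∀ N, (S (N + w)).ncard ≤ (S N).ncard + w := fun N => by
    have hsub : S (N + w) ⊆ S N ∪ monoDeg a b b ⁻¹' Set.Ioc N (N + w) := fun p hp => by
      rcases le_or_gt (monoDeg a b b p) N with h | h
      · exact Or.inl h
      · exact Or.inr ⟨h, hp⟩
    have hfin' : (monoDeg a b b ⁻¹' Set.Ioc N (N + w)).Finite :=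
      (Set.finite_Ioc N (N + w)).preimage hinj.injOn
    calc (S (N + w)).ncard ≤ (S N ∪ monoDeg a b b ⁻¹' Set.Ioc N (N + w)).ncard :=
          Set.ncard_le_ncard hsub ((hfin N).union hfin')
      _ ≤ (S N).ncard + (monoDeg a b b ⁻¹' Set.Ioc N (N + w)).ncard := Set.ncard_union_le _ _
      _ ≤ (S N).ncard + (Set.Ioc N (N + w)).ncard := by
          gcongr
          exact Set.ncard_le_ncard_of_injOn (monoDeg a b b) (fun p hp => hp) hinj.injOn
            (Set.finite_Ioc _ _)
      _ = (S N).ncard + w := by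
          rw [← Finset.coe_Ioc, Set.ncard_coe_finset, Nat.card_Ioc, Nat.add_sub_cancel_left]
  choose r hr using exists_ev_eq_single A B
  have hrN : ∀ p, ∃ N : ℕ, v (r p) ≤ exp (N : ℤ) := fun p => by
    by_cases h : r p = 0
    · exact ⟨0, by simp [h]⟩
    · obtain ⟨u, hu⟩ := hval h
      exact ⟨u, hu.le⟩
  choose u hu using hrN
  -- This `N` is large enough for `L (N + w)` to contain a function with each prescribed indicator
  -- as its values, so evaluation on `Z` is onto.
  set N := Finset.univ.sup u with hN
  have hrL : ∀ p, r p ∈ L (N + w) := fun p => by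
    rw [hmemL]
    refine (hu p).trans (exp_le_exp.2 ?_)
    have := Finset.le_sup (f := u) (Finset.mem_univ p)
    exact_mod_cast this.trans (Nat.le_add_right N w)
  let φ : L (N + w) →ₗ[F] (Z → F) :=
    (LinearMap.funLeft F F (fun p : Z => p.1)).comp ((ev A B).comp (L (N + w)).subtype)
  have hφ : ∀ g p, φ g p = ev A B g.1 p.1 := fun g p => rfl
  have hsurj : Function.Surjective φ := fun c => by
    refine ⟨∑ p : Z, c p • ⟨r p.1, hrL p.1⟩, ?_⟩
    rw [map_sum]
    ext p
    rw [Finset.sum_apply, Finset.sum_eq_single p]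
    · simp [hφ, hr]
    · intro p' _ hp'
      have : p.1 ≠ p'.1 := fun h => hp' (Subtype.ext h.symm)
      simp [hφ, hr, this]
    · simp
  -- Multiplication by `f` raises pole orders by `w` and lands among the functions vanishing on `Z`.
  let ψ : L N →ₗ[F] LinearMap.ker φ :=
    { toFun := fun g => ⟨⟨f * g.1, by
          rw [hmemL, map_mul, hw, Nat.cast_add, add_comm, exp_add]
          gcongr
          exact (hmemL N g.1).1 g.2⟩, by
        rw [LinearMap.mem_ker]
        ext p
        rw [hφ, ev_mul, Pi.mul_apply, hZ p.1 p.2, zero_mul, Pi.zero_apply]⟩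
      map_add' := fun g h => Subtype.ext (Subtype.ext (mul_add f g.1 h.1))
      map_smul' := fun c g => Subtype.ext (Subtype.ext (mul_smul_comm c f g.1)) }
  have hψ : Function.Injective ψ := by
    rw [injective_iff_map_eq_zero]
    intro g hg
    have hfg : f * g.1 = 0 := congrArg (fun z => z.1.1) hg
    by_contra hg0
    obtain ⟨k, hk⟩ := hval (fun h => hg0 (Subtype.ext h) : g.1 ≠ 0)
    have h := congrArg v hfg
    rw [map_mul, hw, hk, map_zero] at h
    simp at h
  -- Rank-nullity gives `#Z + dim ker φ = dim L (N + w) ≤ dim L N + w`, while `dim L N ≤ dim ker φ`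
  -- by injectivity of `ψ`.
  have h1 := LinearMap.finrank_range_add_finrank_ker φ
  rw [LinearMap.range_eq_top.2 hsurj, finrank_top, Module.finrank_fintype_fun_eq_card,
    Fintype.card_coe, hrank] at h1
  have h2 := LinearMap.finrank_le_finrank_of_injective hψ
  rw [hrank] at h2
  have h3 := hcount N
  omega

end Evaluation

/-! ### Completeness in terms of exponents -/

section Spaces

variable {F : Type*} [Field F] {K : Type*} [Field K] [Algebra F K]

theorem funSpace_eq_span_mono (y x : K) {r : ℕ} (ε : Fin r → Fin 2) (ℓ : Fin r → ℕ) :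
    funSpace F y x ε ℓ = Submodule.span F (mono y x r '' {p | ε p.1 = 1 ∧ p.2 ≤ ℓ p.1}) := by
  apply le_antisymm
  · refine iSup_le fun i => iSup_le fun hi => Submodule.span_le.2 ?_
    rintro _ ⟨j, hj, rfl⟩
    exact Submodule.subset_span ⟨(i, j), ⟨hi, hj⟩, rfl⟩
  · rw [Submodule.span_le]
    rintro _ ⟨⟨i, j⟩, ⟨hi, hj⟩, rfl⟩
    exact Submodule.mem_iSup_of_mem i (Submodule.mem_iSup_of_mem hi
      (Submodule.subset_span ⟨j, hj, rfl⟩))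

theorem iSup_span_eq_span_mono (y x : K) (r : ℕ) :
    ⨆ i : Fin r, Submodule.span F (Set.range fun j : ℕ => y ^ j * x ^ (i : ℕ)) =
      Submodule.span F (Set.range (mono y x r)) := by
  rw [← Submodule.span_iUnion]
  congr 1
  ext f
  simp [mono]

/-- Polynomials in `x` and `y` have no poles outside `Q`, so only the bound at `Q` restricts them.
-/
theorem fullSpace_eq_span_mono {Q : Place F K} {y x : K} {a b r : ℕ} (hr : r ≤ b)
    (hab : Nat.Coprime a b) (hQx : Q.IsOnlyPole x) (hQy : Q.IsOnlyPole y)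
    (hx : Q.val x = exp (a : ℤ)) (hy : Q.val y = exp (b : ℤ)) (m : ℤ) :
    fullSpace Q y x r m =
      Submodule.span F (mono y x r '' {p | (monoDeg a b r p : ℤ) ≤ m}) := by
  ext f
  have h := mem_span_image_le_iff (F := F) Q.val (D := fun p => (monoDeg a b r p : ℤ))
    (fun p => by simpa using val_mono (t := 1) Q.val (by simpa using hx) (by simpa using hy) r p)
    (Nat.cast_injective.comp (monoDeg_injective hab hr)) m f
  rw [h, fullSpace, iSup_span_eq_span_mono, Submodule.mem_inf, and_comm]
  clear h
  refine and_congr_right fun hf => ⟨fun h => h.2, fun h => ⟨fun P hP => ?_, h⟩⟩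
  have hxP : x ∈ P.ring := by_contra fun h => hP ((hQx P).1 h)
  have hyP : y ∈ P.ring := by_contra fun h => hP ((hQy P).1 h)
  clear h
  induction hf using Submodule.span_induction with
  | mem f hf =>
    obtain ⟨p, rfl⟩ := hf
    exact P.ring.mul_mem _ _ (pow_mem hyP _) (pow_mem hxP _)
  | zero => exact P.ring.zero_mem
  | add f g _ _ hf hg => exact P.ring.add_mem _ _ hf hg
  | smul c f _ hf =>
    rw [Algebra.smul_def]
    exact P.ring.mul_mem _ _ (P.algebraMap_mem c) hf

theorem mOf_nonneg {Q : Place F K} {y x : K} {a b r : ℕ} (hr : 0 < r)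
    (hx : Q.val x = exp (a : ℤ)) (hy : Q.val y = exp (b : ℤ))
    (ε : Fin r → Fin 2) (ℓ : Fin r → ℕ) : 0 ≤ mOf Q y x ε ℓ := by
  refine le_ciSup_of_le (Set.finite_range _).bddAbove ⟨0, hr⟩ ?_
  rw [Place.poleOrder, Place.poleOrder, hx, hy, log_exp, log_exp]
  positivity

/-- The monomials of a space are those of order at most `m` exactly when the exponents are the
expected integer parts. -/
theorem exponents_eq_iff {a b : ℕ} (ha : 0 < a) (hb : 2 ≤ b) (m : ℤ)
    (ε : Fin (b - 1) → Fin 2) (ℓ : Fin (b - 1) → ℕ) :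
    {p : Fin (b - 1) × ℕ | ε p.1 = 1 ∧ p.2 ≤ ℓ p.1} = {p | (monoDeg a b (b - 1) p : ℤ) ≤ m} ↔
      ∀ i : Fin (b - 1), (ε i = 1 ↔ ((i : ℕ) : ℤ) ≤ min ((b : ℤ) - 2) (m / a)) ∧
        (((i : ℕ) : ℤ) ≤ min ((b : ℤ) - 2) (m / a) →
          (ℓ i : ℤ) = (m - ((i : ℕ) : ℤ) * a) / b) := by
  have ha' : (0 : ℤ) < a := by exact_mod_cast ha
  have hb' : (0 : ℤ) < b := by omega
  -- The cap `b - 2` is automatic for an index below `b - 1`.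
  have hs : ∀ i : Fin (b - 1),
      ((i : ℕ) : ℤ) ≤ min ((b : ℤ) - 2) (m / a) ↔ ((i : ℕ) : ℤ) * a ≤ m := fun i => by
    rw [le_min_iff, Int.le_ediv_iff_mul_le ha']
    have := i.2
    exact ⟨fun h => h.2, fun h => ⟨by omega, h⟩⟩
  have hd : ∀ (i : Fin (b - 1)) (j : ℕ),
      (monoDeg a b (b - 1) (i, j) : ℤ) ≤ m ↔ (j : ℤ) ≤ (m - ((i : ℕ) : ℤ) * a) / b := fun i j => by
    rw [Int.le_ediv_iff_mul_le hb', le_sub_iff_add_le, monoDeg]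
    push_cast
    rfl
  have hnn : ∀ i : Fin (b - 1), ((i : ℕ) : ℤ) * a ≤ m ↔
      0 ≤ (m - ((i : ℕ) : ℤ) * a) / b := fun i => by
    rw [Int.le_ediv_iff_mul_le hb', zero_mul, sub_nonneg]
  simp only [hs, hnn, Set.ext_iff, Prod.forall, Set.mem_ofPred_eq, hd]
  refine forall_congr' fun i => ?_
  set k := (m - ((i : ℕ) : ℤ) * a) / b
  constructor
  -- Testing `j = 0` determines `ε i`; testing `j = ℓ i` and `j = k` gives the two inequalities
  -- between `ℓ i` and `k`.
  · intro h
    have hε : ε i = 1 ↔ 0 ≤ k := by simpa using h 0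
    refine ⟨hε, fun hk => ?_⟩
    obtain ⟨n, hn⟩ := Int.eq_ofNat_of_zero_le hk
    have h1 := (h (ℓ i)).1 ⟨hε.2 hk, le_rfl⟩
    have h2 := ((h n).2 (by rw [hn])).2
    rw [hn] at h1 ⊢
    have h3 : ℓ i ≤ n := by exact_mod_cast h1
    exact congrArg _ (le_antisymm h3 h2)
  · rintro ⟨hε, hk⟩ j
    rw [hε]
    constructor
    · rintro ⟨h0, hj⟩
      rw [← hk h0]
      exact_mod_cast hj
    · intro hj
      have h0 : 0 ≤ k := le_trans (by positivity) hj
      rw [← hk h0] at hj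
      exact ⟨h0, by exact_mod_cast hj⟩

end Spaces

/-! ### Fibres of evaluation points -/

section Codes

variable {F : Type*} [Field F] [Fintype F] [DecidableEq F] {A B : F[X]}

theorem mem_evalCode_iff {K : Type*} [Field K] [Algebra F K] [Algebra (CoordRing A B) K]
    [IsScalarTower F (CoordRing A B) K] (V : Submodule F K) (u : evalPoints A B → F) :
    u ∈ evalCode A B V ↔ ∃ f, algebraMap (CoordRing A B) K f ∈ V ∧ ev A B f = u :=
  Iff.rfl

/-- The evaluation points over `T ⊆ splitSet A B` form full fibres. -/
theorem card_evalPoints_fibre (T : Finset F) (hT : T ⊆ splitSet A B) :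
    ((evalPoints A B).filter fun p => p.2 ∈ T).card = T.card * B.natDegree := by
  have hmaps : Set.MapsTo Prod.snd (↑((evalPoints A B).filter fun p => p.2 ∈ T) : Set (F × F)) (T : Set F) :=
    fun p hp => (Finset.mem_filter.1 hp).2
  rw [Finset.card_eq_sum_card_fiberwise hmaps, ← smul_eq_mul, ← Finset.sum_const]
  refine Finset.sum_congr rfl fun β hβ => ?_
  rw [← (Finset.mem_filter.1 (hT hβ)).2]
  refine Finset.card_bij' (fun p _ => p.1) (fun α _ => (α, β)) ?_ ?_ ?_ ?_
  · rintro ⟨α, β'⟩ h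
    simp only [Finset.mem_filter, evalPoints, Finset.mem_univ, true_and] at h ⊢
    obtain ⟨⟨⟨h1, -⟩, -⟩, rfl⟩ := h
    exact h1.symm
  · intro α h
    simp only [Finset.mem_filter, evalPoints, Finset.mem_univ, true_and] at h ⊢
    exact ⟨⟨⟨h.symm, hT hβ⟩, hβ⟩, trivial⟩
  · rintro ⟨α, β'⟩ h
    rw [← (Finset.mem_filter.1 h).2]
  · intro α h; rfl

theorem card_evalPoints : (evalPoints A B).card = (splitSet A B).card * B.natDegree := by
  rw [← card_evalPoints_fibre _ subset_rfl, Finset.filter_true_of_mem]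
  exact fun p hp => (Finset.mem_filter.1 hp).2.2

end Codes

/-! ### Minimum distance and weights -/

section MinDist

variable {F : Type*} [Field F] [DecidableEq F] {ι : Type*} [Fintype ι]

theorem minDist_le_hammingNorm {𝒞 : Submodule F (ι → F)} {u : ι → F}
    (hu : u ∈ 𝒞) (h0 : u ≠ 0) : minDist 𝒞 ≤ hammingNorm u :=
  Nat.sInf_le ⟨u, hu, 0, 𝒞.zero_mem, h0, hammingDist_zero_right u⟩

/-- A nonzero code has two distinct words, so the infimum is attained, and by linearity the
difference of an extremal pair is a codeword. -/
theorem exists_hammingNorm_eq_minDist {𝒞 : Submodule F (ι → F)}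
    (h : 𝒞 ≠ ⊥) : ∃ u ∈ 𝒞, u ≠ 0 ∧ hammingNorm u = minDist 𝒞 := by
  obtain ⟨c, hc, hc0⟩ := (Submodule.ne_bot_iff _).1 h
  obtain ⟨u, hu, w, hw, huw, hd⟩ := Nat.sInf_mem
    (s := {d | ∃ u ∈ 𝒞, ∃ w ∈ 𝒞, u ≠ w ∧ hammingDist u w = d})
    ⟨_, c, hc, 0, 𝒞.zero_mem, hc0, rfl⟩
  exact ⟨-u + w, 𝒞.add_mem (𝒞.neg_mem hu) hw,
    fun h => huw (by rwa [neg_add_eq_zero] at h), by rw [← hammingDist_eq_hammingNorm, hd]; rfl⟩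

theorem hammingNorm_add_card_zeros (u : ι → F) :
    hammingNorm u + (Finset.univ.filter fun i => u i = 0).card = Fintype.card ι := by
  rw [add_comm]
  exact Finset.card_filter_add_card_filter_not (s := Finset.univ) (fun i => u i = 0)

end MinDist
end SepVar

/-! ### The main theorem -/

theorem mainTheorem10 {F : Type*} [Field F] [Fintype F] [DecidableEq F]
    (a b : ℕ) (A B : Polynomial F) (hA : A.natDegree = a) (hB : B.natDegree = b)
    (hb : 2 ≤ b) (hab : Nat.Coprime a b) (hirr : AbsIrreducible A B)
    {K : Type*} [Field K] [Algebra F K] [Algebra (CoordRing A B) K]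
    [IsScalarTower F (CoordRing A B) K] [IsFractionRing (CoordRing A B) K]
    (x y : K) (hx : x = algebraMap (CoordRing A B) K (xCoord A B))
    (hy : y = algebraMap (CoordRing A B) K (yCoord A B))
    (Q : Place F K) (hQx : Q.IsOnlyPole x) (hQy : Q.IsOnlyPole y)
    (ε : Fin (b - 1) → Fin 2) (ℓ : Fin (b - 1) → ℕ)
    (m s : ℤ) (hm : m = mOf Q y x ε ℓ) (hs : s = min ((b : ℤ) - 2) (m / (a : ℤ)))
    (n : ℕ) (hn : n = (evalPoints A B).card) :
    (IsComplete Q y x ε ℓ ↔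
      ∀ i : Fin (b - 1), (ε i = 1 ↔ ((i : ℕ) : ℤ) ≤ s) ∧
        (((i : ℕ) : ℤ) ≤ s → (ℓ i : ℤ) = (m - ((i : ℕ) : ℤ) * (a : ℤ)) / (b : ℤ))) ∧
    (IsComplete Q y x ε ℓ →
      (0 < n → evalCode A B (funSpace F y x ε ℓ) ≠ ⊥ ∧
        (n : ℤ) - m ≤ (minDist (evalCode A B (funSpace F y x ε ℓ)) : ℤ)) ∧
      (m / (b : ℤ) * (b : ℤ) < (n : ℤ) →
        (minDist (evalCode A B (funSpace F y x ε ℓ)) : ℤ) ≤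
          (n : ℤ) - m / (b : ℤ) * (b : ℤ))) := by
  have hvals := Q.val_coords (A := A) (B := B) (by omega) (by rwa [hA, hB])
    (by rw [← hx]; exact Q.one_lt_val ((hQx Q).2 rfl))
    (by rw [← hy]; exact Q.one_lt_val ((hQy Q).2 rfl))
  have hvx : Q.val x = WithZero.exp (a : ℤ) := by rw [hx, hvals.1, hA]
  have hvy : Q.val y = WithZero.exp (b : ℤ) := by rw [hy, hvals.2, hB]
  have ha : 0 < a := by
    rcases Nat.eq_zero_or_pos a with rfl | h
    · rw [Nat.coprime_zero_left] at hab; omega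
    · exact h
  have hb0 : (0 : ℤ) < b := by omega
  have hm0 : 0 ≤ m := hm ▸ mOf_nonneg (by omega) hvx hvy ε ℓ
  have hfull := fullSpace_eq_span_mono (r := b - 1) (by omega) hab hQx hQy hvx hvy m
  have hli : LinearIndependent F (mono y x (b - 1)) := linearIndependent_of_val_injective Q.val
    (fun p => by
      simpa using val_mono (t := 1) Q.val (by simpa using hvx) (by simpa using hvy) (b - 1) p)
    (Nat.cast_injective.comp (monoDeg_injective hab (by omega)))
  refine ⟨?_, fun hcomp => ?_⟩
  · rw [SepVar.IsComplete, ← hm, hfull, funSpace_eq_span_mono, span_image_eq_iff hli, hs]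
    exact exponents_eq_iff ha hb m ε ℓ
  have hV : funSpace F y x ε ℓ = fullSpace Q y x (b - 1) m := by rw [hm]; exact hcomp
  have hmem : ∀ (f : CoordRing A B), algebraMap (CoordRing A B) K f ∈ funSpace F y x ε ℓ →
      Q.coordVal f ≤ WithZero.exp m := fun f hf => by
    rw [hV] at hf
    exact hf.1.2
  have hcard : Fintype.card (evalPoints A B) = n := by rw [Fintype.card_coe, hn]
  have hpow : ∀ j : ℕ, (j : ℤ) ≤ m / b → y ^ j ∈ funSpace F y x ε ℓ := fun j hj => by
    rw [hV, hfull]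
    refine Submodule.subset_span ⟨(⟨0, by omega⟩, j), ?_, by simp [mono]⟩
    rw [Int.le_ediv_iff_mul_le hb0] at hj
    simpa [monoDeg] using hj
  refine ⟨fun hn0 => ?_, fun hlt => ?_⟩
  · have hne : evalCode A B (funSpace F y x ε ℓ) ≠ ⊥ := by
      rw [Submodule.ne_bot_iff]
      -- The constant 1 lies in `V` because `0 ≤ m`, and it evaluates to the all-ones word.
      refine ⟨1, (mem_evalCode_iff _ _).2 ⟨1, ?_, ev_one A B⟩, fun h => ?_⟩
      · rw [map_one]
        simpa using hpow 0 (by simpa using Int.ediv_nonneg hm0 hb0.le)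
      · rw [← hcard, Fintype.card_pos_iff] at hn0
        exact one_ne_zero (congrFun h hn0.some)
    refine ⟨hne, ?_⟩
    obtain ⟨u, hu, hu0, hd⟩ := exists_hammingNorm_eq_minDist hne
    obtain ⟨f, hf, rfl⟩ := (mem_evalCode_iff _ _).1 hu
    have hz := card_zeros_le (by omega) (by rwa [hB]) Q.coordVal
      (by rw [Place.coordVal_apply, ← hx, hvx]) (by rw [Place.coordVal_apply, ← hy, hvy, hB])
      (f := f) (by rintro rfl; simp at hu0) (hmem f hf)
      (Finset.univ.filter fun p => ev A B f p = 0) (fun p hp => (Finset.mem_filter.1 hp).2)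
    have := hammingNorm_add_card_zeros (ev A B f)
    omega
  · obtain ⟨t, ht⟩ := Int.eq_ofNat_of_zero_le (Int.ediv_nonneg hm0 hb0.le)
    rw [ht] at hlt ⊢
    have hnU : n = (splitSet A B).card * b := by rw [hn, card_evalPoints, hB]
    have htn : t * b < n := by exact_mod_cast hlt
    have htU : t ≤ (splitSet A B).card := by
      rw [hnU] at htn
      exact (Nat.lt_of_mul_lt_mul_right htn).le
    obtain ⟨T, hTU, hTt⟩ := Finset.exists_subset_card_eq htU
    -- The word of `g(y)` vanishes exactly on the `t` fibres over `T`, and `g(y)` lies in `V`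
    -- because its degree `t` is `⌊m / b⌋`.
    set g : Polynomial F := ∏ β ∈ T, (X - C β) with hg
    have hdeg : g.natDegree = t := by rw [hg, natDegree_finsetProd_X_sub_C_eq_card, hTt]
    have hzero : ∀ p, ev A B (aeval (yCoord A B) g) p = 0 ↔ p.1.2 ∈ T := fun p => by
      rw [ev_aeval, ev_yCoord, hg, eval_prod, Finset.prod_eq_zero_iff]
      simp [sub_eq_zero]
    have hcode : ev A B (aeval (yCoord A B) g) ∈ evalCode A B (funSpace F y x ε ℓ) := by
      refine (mem_evalCode_iff _ _).2 ⟨_, ?_, rfl⟩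
      rw [← aeval_algebraMap_apply, ← hy, aeval_eq_sum_range]
      refine Submodule.sum_mem _ fun j hj => Submodule.smul_mem _ _ (hpow j ?_)
      rw [ht]
      rw [Finset.mem_range, hdeg] at hj
      exact_mod_cast Nat.lt_succ_iff.1 hj
    have hcount : (Finset.univ.filter fun p => ev A B (aeval (yCoord A B) g) p = 0).card =
        t * b := by
      rw [← hTt, ← hB, ← card_evalPoints_fibre T hTU]
      simp only [hzero]
      rw [Finset.univ_eq_attach, ← Finset.card_map (Function.Embedding.subtype _)]
      congr 1
      ext p
      simp
      tauto
    have hsum := hammingNorm_add_card_zeros (ev A B (aeval (yCoord A B) g))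
    rw [hcount, hcard] at hsum
    -- The strict inequality `t * b < n` leaves a point where `g(y)` does not vanish.
    have hne : ev A B (aeval (yCoord A B) g) ≠ 0 := fun h => by
      rw [h, hammingNorm_zero] at hsum
      omega
    have hle := minDist_le_hammingNorm hcode hne
    have : (minDist (evalCode A B (funSpace F y x ε ℓ)) : ℤ) + t * b ≤ n := by
      exact_mod_cast (Nat.add_le_add_right hle _).trans hsum.le
    change _ ≤ (n : ℤ) - (t : ℤ) * b
    linarith
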